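/- Let $R$ be a principal ideal domain of characteristic different from $2$, and let $\Delta\in R$ be a nonzero discriminant, i.e. $\Delta\neq 0$ and $\Delta=\pi^2+4n$ for some $\pi,n\in R$; fix such $\pi,n$. A binary quadratic form $[a,b,c]=ax^2+bxy+cy^2$ over $R$ is primitive if $\langle a,b,c\rangle=R$, and its discriminant is $b^2-4ac$. Two forms $q,q'$ are twisted-equivalent if $q'(x,y)=\frac{1}{\alpha\delta-\beta\gamma}\,q(\alpha x+\beta y,\gamma x+\delta y)$ for some $\begin{pmatrix}\alpha&\beta\\ \gamma&\delta\end{pmatrix}\in \mathrm{GL}_2(R)$. Let $\mathrm{Cl}^{tw}_R(\Delta)$ be the set of twisted-equivalence classes of primitive forms of discriminant $\Delta$. For a class $X$, let $H_X\subseteq (R/\Delta R)^\times$ be its set of values, that is, the set of all units of $R/\Delta R$ of the form $q(x,y)$ with $q\in X$ and $x,y\in R/\Delta R$. Let $H_0$ be the set of values of the class of the principal form $[1,\pi,-n]$, where $n=\frac{\Delta-\pi^2}{4}$; it is a subgroup of $(R/\Delta R)^\times$. There is exactly one commutative group structure on $\mathrm{Cl}^{tw}_R(\Delta)$ for which there is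 a group isomorphism $$\mathrm{Cl}^{tw}_R(\Delta)\;\cong\;\mathrm{Pic}\big(R[\omega]/\langle \omega^2+\pi\omega-n\rangle\big)$$ sending the class of each form $[a,b,c]$ with $a\neq 0$ to the class of the ideal $\langle \omega+\tfrac{\pi-b}{2},\,a\rangle$ (in particular $\frac{\pi-b}{2}\in R$); its neutral element is the class of $[1,\pi,-n]$. For this group structure, the following holds. Each $H_X$ is a coset of $H_0$ in $(R/\Delta R)^\times$, so that the map $$\psi\colon \mathrm{Cl}^{tw}_R(\Delta)\longrightarrow (R/\Delta R)^\times/H_0,\qquad X\longmapsto H_X,$$ is well defined, and $\psi$ is a group homomorphism. The kernel of $\psi$ contains the subgroup $\mathrm{Cl}^{tw}_R(\Delta)^{\square}$ of squares; hence $\psi$ factors, through a unique group homomorphism $$\Psi\colon \mathrm{Cl}^{tw}_R(\Delta)/\mathrm{Cl}^{tw}_R(\Delta)^{\square}\longrightarrow (R/\Delta R)^\times/H_0 ,$$ called the Genus map. -/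

import Mathlib

/-- The binary quadratic form `[a, b, c] = a x² + b x y + c y²` with coefficients in `R`. -/
@[ext]
structure BinForm (R : Type*) where
  a : R
  b : R
  c : R

namespace BinForm

variable {R : Type*} [CommRing R]

/-- The value `q(x, y)` at elements `x, y` of an `R`-algebra. -/
def eval (q : BinForm R) {A : Type*} [CommRing A] [Algebra R A] (x y : A) : A :=
  algebraMap R A q.a * x ^ 2 + algebraMap R A q.b * (x * y) + algebraMap R A q.c * y ^ 2

/-- The discriminant `b² - 4ac`. -/
def disc (q : BinForm R) : R := q.b ^ 2 - 4 * q.a * q.c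

/-- `q` is primitive if its coefficients generate the unit ideal. -/
def IsPrimitive (q : BinForm R) : Prop := Ideal.span {q.a, q.b, q.c} = ⊤

/-- The twisted action of `GL₂(R)`: the coefficients of the form
`det(M)⁻¹ q(αx + βy, γx + δy)`, where `M = (α β; γ δ)`; see `BinForm.eval_twist`. -/
def twist (M : GL (Fin 2) R) (q : BinForm R) : BinForm R where
  a := (M.det⁻¹ : Rˣ) * (q.a * M 0 0 ^ 2 + q.b * (M 0 0 * M 1 0) + q.c * M 1 0 ^ 2)
  b := (M.det⁻¹ : Rˣ) * (q.b * (M 0 0 * M 1 1 + M 0 1 * M 1 0)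
        + 2 * (q.a * M 0 0 * M 0 1 + q.c * M 1 0 * M 1 1))
  c := (M.det⁻¹ : Rˣ) * (q.a * M 0 1 ^ 2 + q.b * (M 0 1 * M 1 1) + q.c * M 1 1 ^ 2)

theorem eval_twist (M : GL (Fin 2) R) (q : BinForm R) (x y : R) :
    (twist M q).eval x y =
      (M.det⁻¹ : Rˣ) * q.eval (M 0 0 * x + M 0 1 * y) (M 1 0 * x + M 1 1 * y) := by
  simp only [eval, twist, Algebra.algebraMap_self, RingHom.id_apply]
  ring

theorem det_inv_mul (M : GL (Fin 2) R) :
    ((M.det⁻¹ : Rˣ) : R) * (M 0 0 * M 1 1 - M 0 1 * M 1 0) = 1 := by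
  rw [← Matrix.det_fin_two, ← Matrix.GeneralLinearGroup.val_det_apply, Units.inv_mul]

theorem disc_twist (M : GL (Fin 2) R) (q : BinForm R) : (twist M q).disc = q.disc := by
  have h := det_inv_mul M
  simp only [disc, twist]
  linear_combination (q.b ^ 2 - 4 * q.a * q.c) *
    (((M.det⁻¹ : Rˣ) : R) * (M 0 0 * M 1 1 - M 0 1 * M 1 0) + 1) * h

theorem twist_one (q : BinForm R) : twist 1 q = q := by
  ext <;> simp [twist]

theorem twist_twist (M N : GL (Fin 2) R) (q : BinForm R) :
    twist N (twist M q) = twist (M * N) q := by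
  ext <;> simp only [twist, map_mul, mul_inv, Units.val_mul, Matrix.mul_apply,
    Fin.sum_univ_two] <;> ring

theorem span_twist_le (M : GL (Fin 2) R) (q : BinForm R) :
    Ideal.span {(twist M q).a, (twist M q).b, (twist M q).c} ≤ Ideal.span {q.a, q.b, q.c} := by
  have ha : q.a ∈ Ideal.span {q.a, q.b, q.c} := Ideal.subset_span (by simp)
  have hb : q.b ∈ Ideal.span {q.a, q.b, q.c} := Ideal.subset_span (by simp)
  have hc : q.c ∈ Ideal.span {q.a, q.b, q.c} := Ideal.subset_span (by simp)
  generalize Ideal.span {q.a, q.b, q.c} = I at *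
  have key : ∀ r s t : R, r * q.a + s * q.b + t * q.c ∈ I := fun r s t =>
    I.add_mem (I.add_mem (I.mul_mem_left _ ha) (I.mul_mem_left _ hb)) (I.mul_mem_left _ hc)
  rw [Ideal.span_le]
  rintro z (rfl | rfl | rfl)
  · refine SetLike.mem_coe.mpr ?_
    convert key ((M.det⁻¹ : Rˣ) * M 0 0 ^ 2) ((M.det⁻¹ : Rˣ) * (M 0 0 * M 1 0))
      ((M.det⁻¹ : Rˣ) * M 1 0 ^ 2) using 1
    simp only [twist]; ring
  · refine SetLike.mem_coe.mpr ?_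
    convert key ((M.det⁻¹ : Rˣ) * (2 * M 0 0 * M 0 1))
      ((M.det⁻¹ : Rˣ) * (M 0 0 * M 1 1 + M 0 1 * M 1 0))
      ((M.det⁻¹ : Rˣ) * (2 * M 1 0 * M 1 1)) using 1
    simp only [twist]; ring
  · refine SetLike.mem_coe.mpr ?_
    convert key ((M.det⁻¹ : Rˣ) * M 0 1 ^ 2) ((M.det⁻¹ : Rˣ) * (M 0 1 * M 1 1))
      ((M.det⁻¹ : Rˣ) * M 1 1 ^ 2) using 1
    simp only [twist]; ring

theorem isPrimitive_twist (M : GL (Fin 2) R) {q : BinForm R} (hq : q.IsPrimitive) :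
    (twist M q).IsPrimitive := by
  have h := span_twist_le M⁻¹ (twist M q)
  rw [twist_twist, mul_inv_cancel, twist_one] at h
  exact top_le_iff.mp ((le_of_eq hq.symm).trans h)

end BinForm

/-- Primitive binary quadratic forms over `R` of discriminant `Δ`. -/
def PrimForm (R : Type*) [CommRing R] (Δ : R) : Type _ :=
  {q : BinForm R // q.IsPrimitive ∧ q.disc = Δ}

/-- Twisted equivalence: `q ~ q'` if `q' = M · q` for some `M ∈ GL₂(R)`. -/
instance PrimForm.setoid (R : Type*) [CommRing R] (Δ : R) : Setoid (PrimForm R Δ) where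
  r q q' := ∃ M : GL (Fin 2) R, q'.1 = BinForm.twist M q.1
  iseqv :=
    { refl := fun q => ⟨1, (BinForm.twist_one q.1).symm⟩
      symm := by
        rintro q q' ⟨M, h⟩
        exact ⟨M⁻¹, by rw [h, BinForm.twist_twist, mul_inv_cancel, BinForm.twist_one]⟩
      trans := by
        rintro q q' q'' ⟨M, h⟩ ⟨N, h'⟩
        exact ⟨M * N, by rw [h', h, BinForm.twist_twist]⟩ }

/-- The set `Cl^tw_R(Δ)` of twisted equivalence classes of primitive forms of discriminant `Δ`. -/
def TwistedClass (R : Type*) [CommRing R] (Δ : R) : Type _ :=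
  Quotient (PrimForm.setoid R Δ)

/-- The twisted equivalence class of a primitive form. -/
def PrimForm.toClass {R : Type*} [CommRing R] {Δ : R} (q : PrimForm R Δ) : TwistedClass R Δ :=
  Quotient.mk (PrimForm.setoid R Δ) q

section Values

variable {R : Type*} [CommRing R] {Δ : R}

/-- The set of values of the form `q` in `(R/Δ)ˣ`. -/
def PrimForm.values (q : PrimForm R Δ) : Set (R ⧸ Ideal.span {Δ})ˣ :=
  {u | ∃ x y : R ⧸ Ideal.span {Δ}, (u : R ⧸ Ideal.span {Δ}) = q.1.eval x y}

/-- The set of values `H_q` in `(R/Δ)ˣ` of a class of forms: the union of the sets of values of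
the forms in the class. -/
def TwistedClass.values (X : TwistedClass R Δ) : Set (R ⧸ Ideal.span {Δ})ˣ :=
  ⋃ (q : PrimForm R Δ) (_ : q.toClass = X), q.values

/-- The principal form `[1, π, -n]`, where `Δ = π² + 4n`, that is `n = (Δ - π²)/4`. -/
def principalForm (π n : R) (h : Δ = π ^ 2 + 4 * n) : PrimForm R Δ :=
  ⟨⟨1, π, -n⟩, (Ideal.eq_top_iff_one _).mpr (Ideal.subset_span (by simp)), by
    simp only [BinForm.disc, h]; ring⟩

/-- Elements of `H_q` are the values of `q` up to units of `R`. -/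
theorem PrimForm.mem_values_toClass (q : PrimForm R Δ) (u : (R ⧸ Ideal.span {Δ})ˣ) :
    u ∈ q.toClass.values ↔ ∃ (e : Rˣ) (x y : R ⧸ Ideal.span {Δ}),
      (u : R ⧸ Ideal.span {Δ}) = algebraMap R (R ⧸ Ideal.span {Δ}) e * q.1.eval x y := by
  simp only [TwistedClass.values, Set.mem_iUnion, PrimForm.values, Set.mem_ofPred_eq, exists_prop]
  constructor
  · rintro ⟨q', hq', x, y, hu⟩
    obtain ⟨M, hM⟩ := Quotient.exact hq'.symm
    refine ⟨M.det⁻¹, algebraMap R _ (M 0 0) * x + algebraMap R _ (M 0 1) * y,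
      algebraMap R _ (M 1 0) * x + algebraMap R _ (M 1 1) * y, ?_⟩
    rw [hu, hM]
    simp only [BinForm.eval, BinForm.twist, map_mul, map_add, map_pow, map_ofNat]
    ring
  · rintro ⟨e, x, y, hu⟩
    let M : GL (Fin 2) R :=
      ⟨!![1, 0; 0, ((e⁻¹ : Rˣ) : R)], !![1, 0; 0, (e : R)],
        by ext i j; fin_cases i <;> fin_cases j <;> simp,
        by ext i j; fin_cases i <;> fin_cases j <;> simp⟩
    have hdet : M.det = e⁻¹ := by
      ext; simp [M, Matrix.det_fin_two]
    refine ⟨⟨BinForm.twist M q.1, BinForm.isPrimitive_twist M q.2.1,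
      (BinForm.disc_twist M q.1).trans q.2.2⟩, (Quotient.sound ⟨M, rfl⟩ : q.toClass = _).symm,
      x, algebraMap R _ (e : R) * y, ?_⟩
    have he : algebraMap R (R ⧸ Ideal.span {Δ}) ((e⁻¹ : Rˣ) : R) *
        algebraMap R (R ⧸ Ideal.span {Δ}) (e : R) = 1 := by
      rw [← map_mul, Units.inv_mul, map_one]
    have hM : M 0 0 = 1 ∧ M 0 1 = 0 ∧ M 1 0 = 0 ∧ M 1 1 = ((e⁻¹ : Rˣ) : R) := by
      simp [M]
    obtain ⟨h00, h01, h10, h11⟩ := hM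
    rw [hu]
    simp only [BinForm.eval, BinForm.twist, hdet, h00, h01, h10, h11, inv_inv, map_mul, map_add,
      map_pow, map_zero, map_one, map_ofNat]
    generalize algebraMap R (R ⧸ Ideal.span {Δ}) ((e⁻¹ : Rˣ) : R) = f at *
    generalize algebraMap R (R ⧸ Ideal.span {Δ}) (e : R) = g at *
    generalize algebraMap R (R ⧸ Ideal.span {Δ}) q.1.b = b
    generalize algebraMap R (R ⧸ Ideal.span {Δ}) q.1.c = c
    linear_combination (-(g * b * x * y) - g * c * y ^ 2 * (f * g + 1)) * he

/-- The subgroup `H₀` of `(R/Δ)ˣ`: its elements are the values of the principal form class. -/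
def principalValues (π n : R) (h : Δ = π ^ 2 + 4 * n) : Subgroup (R ⧸ Ideal.span {Δ})ˣ where
  carrier := (principalForm π n h).toClass.values
  one_mem' := by
    rw [PrimForm.mem_values_toClass]
    exact ⟨1, 1, 0, by simp [BinForm.eval, principalForm]⟩
  mul_mem' := by
    intro u v hu hv
    rw [PrimForm.mem_values_toClass] at *
    obtain ⟨e, x, y, hu⟩ := hu
    obtain ⟨f, z, w, hv⟩ := hv
    refine ⟨e * f, x * z + algebraMap R _ n * (y * w),
      x * w + z * y + algebraMap R _ π * (y * w), ?_⟩
    rw [Units.val_mul, hu, hv]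
    simp only [BinForm.eval, principalForm, Units.val_mul, map_mul, map_one, map_neg]
    ring
  inv_mem' := by
    intro u hu
    rw [PrimForm.mem_values_toClass] at *
    obtain ⟨e, x, y, hu⟩ := hu
    have he : algebraMap R (R ⧸ Ideal.span {Δ}) ((e⁻¹ : Rˣ) : R) *
        algebraMap R (R ⧸ Ideal.span {Δ}) (e : R) = 1 := by
      rw [← map_mul, Units.inv_mul, map_one]
    have hw : (u : R ⧸ Ideal.span {Δ}) * ((u⁻¹ : (R ⧸ Ideal.span {Δ})ˣ) : R ⧸ Ideal.span {Δ})
        = 1 := u.mul_inv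
    refine ⟨e, x * ((u⁻¹ : (R ⧸ Ideal.span {Δ})ˣ) : R ⧸ Ideal.span {Δ}),
      y * ((u⁻¹ : (R ⧸ Ideal.span {Δ})ˣ) : R ⧸ Ideal.span {Δ}), ?_⟩
    generalize ((u⁻¹ : (R ⧸ Ideal.span {Δ})ˣ) : R ⧸ Ideal.span {Δ}) = w at *
    simp only [BinForm.eval] at *
    linear_combination -w * hw + w ^ 2 * hu

end Values

section Composition

variable {R : Type*} [CommRing R]

/-- `R[ω]/(ω² + πω - n)`. When `Δ = π² + 4n` this is the quadratic algebra of discriminant `Δ`. -/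
abbrev QuadAlg (π n : R) : Type _ := QuadraticAlgebra R n (-π)

/-- A commutative group structure on `Cl^tw_R(Δ)` is the composition law if it is transported from
`Pic(R[ω]/(ω² + πω - n))` by the bijection which sends the class of a form `[a, b, c]` with `a ≠ 0`
to the class of the ideal `⟨ω + (π - b)/2, a⟩`. -/
def IsCompositionLaw {Δ : R} (π n : R) (G : CommGroup (TwistedClass R Δ)) : Prop :=
  ∃ Φ : TwistedClass R Δ ≃* CommRing.Pic (QuadAlg π n),
    ∀ q : PrimForm R Δ, q.1.a ≠ 0 →
      ∃ t : R, 2 * t = π - q.1.b ∧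
        Nonempty ((Φ q.toClass).AsModule ≃ₗ[QuadAlg π n]
          (Ideal.span {QuadraticAlgebra.omega + algebraMap R (QuadAlg π n) t,
            algebraMap R (QuadAlg π n) q.1.a} : Ideal (QuadAlg π n)))

end Composition

/-!
Put `t = (π - b)/2`. On the basis `(a, -(ω + t))` of the ideal `⟨ω + t, a⟩`, multiplication by `ω`
is given by a matrix determined by `[a, b, c]`, and a change of basis of this ideal is exactly the
twisted action on the form. As invertible modules over `R[ω]` are free of rank two over the
principal ideal domain `R`, and primitivity of the form amounts to invertibility of the module,
twisted classes of primitive forms correspond to isomorphism classes of invertible modules, and the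
group structure is transported along this bijection. Any two classes contain forms with the same `t`
and coprime first coefficients `a₁`, `a₂`; since `⟨ω + t, a₁⟩⟨ω + t, a₂⟩ = ⟨ω + t, a₁a₂⟩`, the
product of the two classes contains a form with first coefficient `a₁a₂`.

For the values, `a q(x, y) = q₀(ax - ty, y)`, where `q₀ = [1, π, -n]`. When `a` is a unit modulo `Δ`
the values of `q` therefore form the coset `a⁻¹H₀`, which is `aH₀` because `H₀` contains all
squares. So the genus is multiplicative in `a`, and it kills squares because its target does.
-/

namespace BinForm

section CommRing

variable {R : Type*} [CommRing R] {q : BinForm R} {π n t : R}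

theorem eval_self (q : BinForm R) (x y : R) :
    q.eval x y = q.a * x ^ 2 + q.b * (x * y) + q.c * y ^ 2 := rfl

theorem dvd_eval_sub_eval (q : BinForm R) {d x y x' y' : R} (hx : d ∣ x - x') (hy : d ∣ y - y') :
    d ∣ q.eval x y - q.eval x' y' := by
  obtain ⟨u, hu⟩ := hx
  obtain ⟨v, hv⟩ := hy
  obtain rfl : x = x' + d * u := by linear_combination hu
  obtain rfl : y = y' + d * v := by linear_combination hv
  refine ⟨q.a * (2 * x' * u + d * u ^ 2) + q.b * (x' * v + y' * u + d * u * v)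
    + q.c * (2 * y' * v + d * v ^ 2), ?_⟩
  simp only [eval_self]
  ring

theorem eval_mul_mul (q : BinForm R) (d x y : R) :
    q.eval (d * x) (d * y) = d ^ 2 * q.eval x y := by
  simp only [eval_self]
  ring

theorem isPrimitive_iff (q : BinForm R) :
    q.IsPrimitive ↔ ∃ r s t : R, r * q.a + s * q.b + t * q.c = 1 := by
  simp only [IsPrimitive, Ideal.eq_top_iff_one, Ideal.mem_span_insert, Ideal.mem_span_singleton']
  constructor
  · rintro ⟨r, _, ⟨s, _, ⟨t, rfl⟩, rfl⟩, h⟩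
    exact ⟨r, s, t, by rw [h, add_assoc]⟩
  · rintro ⟨r, s, t, h⟩
    exact ⟨r, _, ⟨s, _, ⟨t, rfl⟩, rfl⟩, by rw [← h, add_assoc]⟩

/- The coefficients of `q` are combinations of its values at `(1, 0)`, `(0, 1)` and `(1, 1)`. -/
theorem IsPrimitive.exists_eval_notMem (hq : q.IsPrimitive) {I : Ideal R} (hI : I ≠ ⊤) :
    ∃ x y : R, q.eval x y ∉ I := by
  by_contra! h
  have ha : q.a ∈ I := by simpa [eval_self] using h 1 0
  have hc : q.c ∈ I := by simpa [eval_self] using h 0 1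
  have hb : q.b ∈ I := by
    convert I.sub_mem (I.sub_mem (h 1 1) ha) hc using 1
    rw [eval_self]
    ring
  refine hI (top_le_iff.mp (hq.ge.trans (Ideal.span_le.mpr ?_)))
  rintro _ (rfl | rfl | rfl) <;> assumption

theorem exists_gl_eq {α β γ δ : R} (h : α * δ - β * γ = 1) :
    ∃ M : GL (Fin 2) R, M.det = 1 ∧ M 0 0 = α ∧ M 0 1 = β ∧ M 1 0 = γ ∧ M 1 1 = δ := by
  have hdet : !![α, β; γ, δ].det = 1 := by rw [Matrix.det_fin_two_of, h]
  refine ⟨Matrix.nonsingInvUnit _ (hdet ▸ isUnit_one), Units.ext hdet, ?_⟩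
  simp [Matrix.nonsingInvUnit]

theorem exists_twist_a_eq_eval (q : BinForm R) {x y : R} (h : IsCoprime x y) :
    ∃ M : GL (Fin 2) R, (twist M q).a = q.eval x y := by
  obtain ⟨u, v, huv⟩ := h
  obtain ⟨M, hdet, hα, -, hγ, -⟩ :=
    exists_gl_eq (by linear_combination huv : x * u - -v * y = 1)
  exact ⟨M, by simp only [twist, hdet, hα, hγ, inv_one, Units.val_one, one_mul, eval_self]⟩

theorem exists_twist_eq_translate (q : BinForm R) (k : R) :
    ∃ M : GL (Fin 2) R,
      twist M q = ⟨q.a, q.b + 2 * (q.a * k), q.a * k ^ 2 + q.b * k + q.c⟩ := by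
  obtain ⟨M, hdet, hα, hβ, hγ, hδ⟩ := exists_gl_eq (by ring : 1 * 1 - k * 0 = 1)
  refine ⟨M, ?_⟩
  simp only [twist, hdet, hα, hβ, hγ, hδ, inv_one, Units.val_one]
  ext <;> ring

/-- `q.HasShift π n t` expresses that `q = [a, b, c]` has discriminant `π² + 4n` and that
`t = (π - b)/2` is the shift in the ideal `⟨ω + t, a⟩` attached to `q`. The condition on the
discriminant is divided by four: it becomes `ac = t² - πt - n`, the norm of `ω + t`. -/
structure HasShift (q : BinForm R) (π n t : R) : Prop where
  two_mul_eq : 2 * t = π - q.b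
  a_mul_c : q.a * q.c = t ^ 2 - π * t - n

theorem HasShift.disc_eq (h : q.HasShift π n t) : q.disc = π ^ 2 + 4 * n := by
  rw [disc]
  linear_combination (q.b - 2 * t + π) * h.two_mul_eq - 4 * h.a_mul_c

theorem HasShift.translate (h : q.HasShift π n t) (k : R) :
    HasShift ⟨q.a, q.b + 2 * (q.a * k), q.a * k ^ 2 + q.b * k + q.c⟩ π n (t - q.a * k) where
  two_mul_eq := by linear_combination h.two_mul_eq
  a_mul_c := by linear_combination h.a_mul_c + q.a * k * h.two_mul_eq

theorem IsPrimitive.compose {a₁ a₂ b c : R} (h₁ : IsPrimitive ⟨a₁, b, a₂ * c⟩)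
    (h₂ : IsPrimitive ⟨a₂, b, a₁ * c⟩) : IsPrimitive ⟨a₁ * a₂, b, c⟩ := by
  obtain ⟨r, s, t, h⟩ := (isPrimitive_iff _).mp h₁
  obtain ⟨r', s', t', h'⟩ := (isPrimitive_iff _).mp h₂
  exact (isPrimitive_iff _).mpr ⟨r * r', r * a₁ * s' + s, t * a₂ + r * a₁ * t' * a₁, by
    linear_combination h + r * a₁ * h'⟩

end CommRing

section IsDomain

variable {R : Type*} [CommRing R] [IsDomain R] {q : BinForm R} {π n t : R}

theorem hasShift_of_two_mul_eq (h2 : (2 : R) ≠ 0) (hq : q.disc = π ^ 2 + 4 * n)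
    (ht : 2 * t = π - q.b) : q.HasShift π n t where
  two_mul_eq := ht
  a_mul_c := by
    refine mul_left_cancel₀ h2 (mul_left_cancel₀ h2 ?_)
    rw [disc] at hq
    linear_combination -hq - (2 * t - π - q.b) * ht

/- `(π - b)/2` is integral over `R`, being a root of `X² - πX - (ac + n)`. -/
theorem exists_hasShift [IsIntegrallyClosed R] (h2 : (2 : R) ≠ 0)
    (hq : q.disc = π ^ 2 + 4 * n) : ∃ t, q.HasShift π n t := by
  let K := FractionRing R
  have h2K : (2 : K) ≠ 0 := by
    rw [← map_ofNat (algebraMap R K)]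
    exact (map_ne_zero_iff _ (IsFractionRing.injective R K)).mpr h2
  obtain ⟨x, hx⟩ : ∃ x : K, 2 * x = algebraMap R K (π - q.b) := ⟨_, mul_div_cancel₀ _ h2K⟩
  have hint : IsIntegral R x := by
    refine ⟨.X ^ 2 - .C π * .X - .C (q.a * q.c + n), by monicity!, ?_⟩
    have hqK := congrArg (algebraMap R K) hq
    simp only [disc, map_sub, map_add, map_mul, map_pow, map_ofNat] at hqK hx
    simp only [Polynomial.eval₂_sub, Polynomial.eval₂_pow, Polynomial.eval₂_X,
      Polynomial.eval₂_mul, Polynomial.eval₂_C]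
    rw [map_add, map_mul]
    refine mul_left_cancel₀ h2K (mul_left_cancel₀ h2K ?_)
    linear_combination (2 * x - algebraMap R K π - algebraMap R K q.b) * hx + hqK
  obtain ⟨t, rfl⟩ := IsIntegrallyClosed.isIntegral_iff.mp hint
  refine ⟨t, hasShift_of_two_mul_eq h2 hq (IsFractionRing.injective R K ?_)⟩
  rw [map_mul, map_ofNat, hx]

theorem IsPrimitive.exists_isCoprime_eval [IsPrincipalIdealRing R] (hq : q.IsPrimitive) {N : R}
    (hN : N ≠ 0) : ∃ x y : R, q.eval x y ≠ 0 ∧ IsCoprime (q.eval x y) N := by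
  induction N using UniqueFactorizationMonoid.induction_on_prime with
  | h₁ => exact absurd rfl hN
  | h₂ N hu =>
    obtain ⟨x, y, h⟩ := hq.exists_eval_notMem (I := ⊥) bot_ne_top
    exact ⟨x, y, h, isCoprime_one_right.of_isCoprime_of_dvd_right hu.dvd⟩
  | h₃ N p hN' hp ih =>
    obtain ⟨x₀, y₀, h₀, hco⟩ := ih hN'
    by_cases hdvd : p ∣ q.eval x₀ y₀
    · obtain ⟨x₁, y₁, h₁⟩ := hq.exists_eval_notMem (I := Ideal.span {p})
        (mt Ideal.span_singleton_eq_top.mp hp.not_isUnit)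
      rw [Ideal.mem_span_singleton] at h₁
      obtain ⟨u, v, huv⟩ := hco.of_isCoprime_of_dvd_left hdvd
      let x := u * p * x₀ + v * N * x₁
      let y := u * p * y₀ + v * N * y₁
      have hp_dvd : p ∣ q.eval x y - q.eval x₁ y₁ := q.dvd_eval_sub_eval
        ⟨u * (x₀ - x₁), by linear_combination x₁ * huv⟩
        ⟨u * (y₀ - y₁), by linear_combination y₁ * huv⟩
      have hN_dvd : N ∣ q.eval x y - q.eval x₀ y₀ := q.dvd_eval_sub_eval
        ⟨v * (x₁ - x₀), by linear_combination x₀ * huv⟩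
        ⟨v * (y₁ - y₀), by linear_combination y₀ * huv⟩
      have hp_not_dvd : ¬ p ∣ q.eval x y := fun h => h₁ ((dvd_sub_right h).mp hp_dvd)
      refine ⟨x, y, fun h => hp_not_dvd (h ▸ dvd_zero p), .mul_right ?_ ?_⟩
      · exact (hp.irreducible.coprime_iff_not_dvd.mpr hp_not_dvd).symm
      · obtain ⟨k, hk⟩ := hN_dvd
        rw [sub_eq_iff_eq_add'.mp hk]
        exact hco.add_mul_left_left k
    · exact ⟨x₀, y₀, h₀, (hp.irreducible.coprime_iff_not_dvd.mpr hdvd).symm.mul_right hco⟩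

theorem IsPrimitive.exists_isCoprime_isCoprime_eval [IsPrincipalIdealRing R] (hq : q.IsPrimitive)
    {N : R} (hN : N ≠ 0) :
    ∃ x y : R, IsCoprime x y ∧ q.eval x y ≠ 0 ∧ IsCoprime (q.eval x y) N := by
  obtain ⟨x, y, hne, hco⟩ := hq.exists_isCoprime_eval hN
  classical
  let : GCDMonoid R := IsBezout.toGCDDomain R
  obtain ⟨x', y', hx, hy, hco'⟩ := extract_gcd x y
  have heval : q.eval x y = gcd x y ^ 2 * q.eval x' y' :=
    (congrArg₂ q.eval hx hy).trans (q.eval_mul_mul _ _ _)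
  rw [heval] at hne hco
  exact ⟨x', y', (gcd_isUnit_iff x' y').mp hco', right_ne_zero_of_mul hne, hco.of_mul_left_right⟩

end IsDomain

end BinForm

namespace PrimForm

variable {R : Type*} [CommRing R] {Δ : R}

/-- The twisted action of `GL₂(R)` on the primitive forms of discriminant `Δ`. -/
def twist (M : GL (Fin 2) R) (q : PrimForm R Δ) : PrimForm R Δ :=
  ⟨q.1.twist M, BinForm.isPrimitive_twist M q.2.1, (BinForm.disc_twist M q.1).trans q.2.2⟩

theorem toClass_twist (M : GL (Fin 2) R) (q : PrimForm R Δ) : (q.twist M).toClass = q.toClass :=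
  (Quotient.sound ⟨M, rfl⟩ : q.toClass = _).symm

theorem toClass_eq_toClass {q q' : PrimForm R Δ} :
    q.toClass = q'.toClass ↔ ∃ M : GL (Fin 2) R, q'.1 = BinForm.twist M q.1 :=
  ⟨fun h => Quotient.exact h, fun h => Quotient.sound h⟩

theorem exists_translate (q : PrimForm R Δ) {π n t : R} (h : q.1.HasShift π n t) (k : R) :
    ∃ q' : PrimForm R Δ, q'.toClass = q.toClass ∧ q'.1.a = q.1.a ∧
      q'.1.HasShift π n (t - q.1.a * k) := by
  obtain ⟨M, hM⟩ := q.1.exists_twist_eq_translate k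
  have hM' : (q.twist M).1 = _ := hM
  exact ⟨q.twist M, q.toClass_twist M, by rw [hM'], by rw [hM']; exact h.translate k⟩

theorem exists_a_eq_mul_hasShift {q₁ q₂ : PrimForm R Δ} {π n t : R} (h₁ : q₁.1.HasShift π n t)
    (h₂ : q₂.1.HasShift π n t) (hco : IsCoprime q₁.1.a q₂.1.a) :
    ∃ q : PrimForm R Δ, q.1.a = q₁.1.a * q₂.1.a ∧ q.1.HasShift π n t := by
  obtain ⟨u, v, huv⟩ := hco
  have hb : q₂.1.b = q₁.1.b := by linear_combination h₂.two_mul_eq - h₁.two_mul_eq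
  have hac : q₁.1.a * q₁.1.c = q₂.1.a * q₂.1.c := h₁.a_mul_c.trans h₂.a_mul_c.symm
  let c := v * q₁.1.c + u * q₂.1.c
  have hc₁ : q₁.1.c = q₂.1.a * c := by linear_combination u * hac - q₁.1.c * huv
  have hc₂ : q₂.1.c = q₁.1.a * c := by linear_combination -v * hac - q₂.1.c * huv
  have hshift : BinForm.HasShift ⟨q₁.1.a * q₂.1.a, q₁.1.b, c⟩ π n t :=
    ⟨h₁.two_mul_eq, by rw [mul_assoc, ← hc₁, h₁.a_mul_c]⟩
  have hprim : BinForm.IsPrimitive ⟨q₁.1.a * q₂.1.a, q₁.1.b, c⟩ := .compose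
    (by rw [← hc₁]; exact q₁.2.1) (by rw [← hc₂, ← hb]; exact q₂.2.1)
  exact ⟨⟨_, hprim, by rw [hshift.disc_eq, ← h₁.disc_eq, q₁.2.2]⟩, rfl, hshift⟩

/-- Dirichlet's concordant pairs: both forms have the same shift, equivalently the same middle
coefficient, and their first coefficients are coprime to each other and to `Δ`. -/
structure IsConcordant (π n t : R) (q₁ q₂ : PrimForm R Δ) : Prop where
  hasShift_left : q₁.1.HasShift π n t
  hasShift_right : q₂.1.HasShift π n t
  a_left_ne_zero : q₁.1.a ≠ 0
  a_right_ne_zero : q₂.1.a ≠ 0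
  isCoprime : IsCoprime q₁.1.a q₂.1.a
  isCoprime_left_disc : IsCoprime q₁.1.a Δ
  isCoprime_right_disc : IsCoprime q₂.1.a Δ

end PrimForm

namespace TwistedClass

variable {R : Type*} [CommRing R] [IsDomain R] [IsPrincipalIdealRing R] {Δ : R}

theorem exists_isCoprime_a (X : TwistedClass R Δ) {N : R} (hN : N ≠ 0) :
    ∃ q : PrimForm R Δ, q.toClass = X ∧ q.1.a ≠ 0 ∧ IsCoprime q.1.a N := by
  obtain ⟨q, rfl⟩ : ∃ q : PrimForm R Δ, q.toClass = X := Quotient.exists_rep X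
  obtain ⟨x, y, hxy, hne, hco⟩ := q.2.1.exists_isCoprime_isCoprime_eval hN
  obtain ⟨M, hM⟩ := q.1.exists_twist_a_eq_eval hxy
  exact ⟨q.twist M, q.toClass_twist M, hM ▸ hne, hM ▸ hco⟩

theorem exists_isConcordant (h2 : (2 : R) ≠ 0) (hΔ : Δ ≠ 0) {π n : R} (hπ : Δ = π ^ 2 + 4 * n)
    (X Y : TwistedClass R Δ) : ∃ (p₁ p₂ : PrimForm R Δ) (t : R),
      p₁.toClass = X ∧ p₂.toClass = Y ∧ PrimForm.IsConcordant π n t p₁ p₂ := by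
  obtain ⟨q₁, hX, ha₁, hΔ₁⟩ := X.exists_isCoprime_a hΔ
  obtain ⟨q₂, hY, ha₂, hco⟩ := Y.exists_isCoprime_a (mul_ne_zero hΔ ha₁)
  obtain ⟨t₁, ht₁⟩ := BinForm.exists_hasShift h2 (q₁.2.2.trans hπ)
  obtain ⟨t₂, ht₂⟩ := BinForm.exists_hasShift h2 (q₂.2.2.trans hπ)
  obtain ⟨v, u, hvu⟩ := hco.of_mul_right_right
  obtain ⟨p₁, hp₁, hpa₁, hpt₁⟩ := q₁.exists_translate ht₁ (u * (t₁ - t₂))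
  obtain ⟨p₂, hp₂, hpa₂, hpt₂⟩ := q₂.exists_translate ht₂ (v * (t₂ - t₁))
  have hshift : t₂ - q₂.1.a * (v * (t₂ - t₁)) = t₁ - q₁.1.a * (u * (t₁ - t₂)) := by
    linear_combination (t₁ - t₂) * hvu
  refine ⟨p₁, p₂, _, hp₁.trans hX, hp₂.trans hY, hpt₁, hshift ▸ hpt₂, ?_, ?_, ?_, ?_, ?_⟩
  all_goals simp only [hpa₁, hpa₂]
  exacts [ha₁, ha₂, hco.of_mul_right_right.symm, hΔ₁, hco.of_mul_right_left]

end TwistedClass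

namespace BinForm

variable {R : Type*} [CommRing R] {q q' : BinForm R} {π t t' : R}

/-- With `t = (π - b)/2`, the matrix of multiplication by `ω` on the ideal `⟨ω + t, a⟩` in the basis
`(a, -(ω + t))`; the sign makes `BinForm.twist` correspond to the change of basis. -/
def omegaMatrix (π : R) (q : BinForm R) (t : R) : Matrix (Fin 2) (Fin 2) R :=
  !![-t, q.c; -q.a, t - π]

theorem eq_of_omegaMatrix_eq (ht : 2 * t = π - q.b) (ht' : 2 * t' = π - q'.b)
    (h : q.omegaMatrix π t = q'.omegaMatrix π t') : q = q' := by
  simp only [omegaMatrix, EmbeddingLike.apply_eq_iff_eq, Matrix.vecCons_inj,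
    neg_inj, and_true] at h
  obtain ⟨⟨htt, hc⟩, ha, -⟩ := h
  ext
  · exact ha
  · linear_combination ht - ht' - 2 * htt
  · exact hc

theorem exists_omegaMatrix_mul (ht : 2 * t = π - q.b) (G : GL (Fin 2) R) :
    ∃ t', 2 * t' = π - (twist G q).b ∧
      q.omegaMatrix π t * G.1 = G.1 * (twist G q).omegaMatrix π t' := by
  have hdet := det_inv_mul G
  obtain ⟨a, b, c⟩ := q
  obtain rfl : b = π - 2 * t := by linear_combination ht
  refine ⟨(G.det⁻¹ : Rˣ) * (t * (G 0 0 * G 1 1 + G 0 1 * G 1 0) - π * (G 0 1 * G 1 0)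
    - a * G 0 0 * G 0 1 - c * G 1 0 * G 1 1), ?_, ?_⟩
  · simp only [twist]
    linear_combination π * hdet
  · ext i j
    simp only [omegaMatrix, twist, Matrix.mul_apply, Fin.sum_univ_two]
    fin_cases i <;> fin_cases j <;>
      simp only [Fin.zero_eta, Fin.mk_one, Matrix.of_apply, Matrix.cons_val_zero,
        Matrix.cons_val_one, Matrix.cons_val', Matrix.cons_val_fin_one]
    · linear_combination (t * G 0 0 - c * G 1 0) * hdet
    · linear_combination ((t - π) * G 0 1 - c * G 1 1) * hdet
    · linear_combination (a * G 0 0 - (t - π) * G 1 0) * hdet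
    · linear_combination (a * G 0 1 - t * G 1 1) * hdet

end BinForm

open Module QuadraticAlgebra
open scoped TensorProduct

section Models

variable {R : Type*} [CommRing R] {π n : R}
  {M : Type*} [AddCommGroup M] [Module R M] [Module (QuadAlg π n) M]
  [IsScalarTower R (QuadAlg π n) M]
  {M' : Type*} [AddCommGroup M'] [Module R M'] [Module (QuadAlg π n) M']
  [IsScalarTower R (QuadAlg π n) M']

namespace QuadAlg

theorem smul_eq (s : QuadAlg π n) (m : M) :
    s • m = s.re • m + s.im • (omega : QuadAlg π n) • m := by
  conv_lhs => rw [← mk_eta s, mk_eq_add_smul_omega]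
  rw [add_smul, smul_assoc, algebraMap_smul]

variable (π n M) in
/-- Multiplication by `ω` as an `R`-linear map. -/
abbrev omegaEnd : End R M := Algebra.lsmul R R M (omega : QuadAlg π n)

theorem nonempty_linearEquiv_of_comp_eq (E : M ≃ₗ[R] M')
    (h : E ∘ₗ omegaEnd π n M = omegaEnd π n M' ∘ₗ E) : Nonempty (M ≃ₗ[QuadAlg π n] M') := by
  refine ⟨{ E with map_smul' := fun s m => ?_ }⟩
  have hω : E ((omega : QuadAlg π n) • m) = (omega : QuadAlg π n) • E m := LinearMap.congr_fun h m
  change E (s • m) = s • E m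
  rw [smul_eq s m, smul_eq s (E m), map_add, map_smul, map_smul, hω]

theorem nonempty_linearEquiv_of_toMatrix_eq {ι : Type*} [Fintype ι] [DecidableEq ι]
    (e : Basis ι R M) (e' : Basis ι R M')
    (h : LinearMap.toMatrix e e (omegaEnd π n M) = LinearMap.toMatrix e' e' (omegaEnd π n M')) :
    Nonempty (M ≃ₗ[QuadAlg π n] M') := by
  refine nonempty_linearEquiv_of_comp_eq (e.equiv e' (.refl ι)) (e.ext fun i => ?_)
  rw [← Matrix.toLin_toMatrix e e (omegaEnd π n M), ← Matrix.toLin_toMatrix e' e' (omegaEnd π n M'),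
    h]
  simp only [LinearMap.comp_apply, LinearEquiv.coe_coe, Basis.equiv_apply, Equiv.refl_apply,
    Matrix.toLin_self, map_sum, map_smul]

theorem toMatrix_omegaEnd_eq_iff {q : BinForm R} {t : R} (e : Basis (Fin 2) R M) :
    LinearMap.toMatrix e e (omegaEnd π n M) = q.omegaMatrix π t ↔
      (omega : QuadAlg π n) • e 0 = -t • e 0 + -q.a • e 1 ∧
        (omega : QuadAlg π n) • e 1 = q.c • e 0 + (t - π) • e 1 := by
  have hcol (j : Fin 2) : Matrix.toLin e e (q.omegaMatrix π t) (e j) =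
      q.omegaMatrix π t 0 j • e 0 + q.omegaMatrix π t 1 j • e 1 := by
    rw [Matrix.toLin_self, Fin.sum_univ_two]
  rw [← LinearEquiv.eq_symm_apply, LinearMap.toMatrix_symm]
  refine ⟨fun h => ?_, fun ⟨h₀, h₁⟩ => e.ext fun j => ?_⟩
  · exact ⟨(LinearMap.congr_fun h (e 0)).trans (hcol 0),
      (LinearMap.congr_fun h (e 1)).trans (hcol 1)⟩
  · fin_cases j
    exacts [h₀.trans (hcol 0).symm, h₁.trans (hcol 1).symm]

end QuadAlg

variable (π n) in
/-- `M` is a model of the form `q` if `ω` acts on some `R`-basis of `M` as on the basis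
`(a, -(ω + t))` of the ideal `⟨ω + t, a⟩`, where `t = (π - b)/2`. -/
def IsModel (q : BinForm R) (M : Type*) [AddCommGroup M] [Module R M] [Module (QuadAlg π n) M]
    [IsScalarTower R (QuadAlg π n) M] : Prop :=
  ∃ (e : Basis (Fin 2) R M) (t : R), 2 * t = π - q.b ∧
    LinearMap.toMatrix e e (QuadAlg.omegaEnd π n M) = q.omegaMatrix π t

namespace IsModel

variable {q q' : BinForm R}

theorem congr (h : IsModel π n q M) (f : M ≃ₗ[QuadAlg π n] M') : IsModel π n q M' := by
  obtain ⟨e, t, ht, hA⟩ := h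
  refine ⟨e.map (f.restrictScalars R), t, ht, ?_⟩
  rw [← hA]
  ext i j
  simp [LinearMap.toMatrix_apply]

theorem twist (h : IsModel π n q M) (G : GL (Fin 2) R) : IsModel π n (q.twist G) M := by
  obtain ⟨e, t, ht, hA⟩ := h
  obtain ⟨t', ht', hAG⟩ := BinForm.exists_omegaMatrix_mul ht G
  let e' := e.map (Matrix.toLinOfInv e e G.mul_inv G.inv_mul)
  have he' : e.toMatrix e' = G.1 := by
    rw [← LinearMap.toMatrix_toLin e e G.1]
    ext i j
    simp [e', Basis.toMatrix_apply, LinearMap.toMatrix_apply]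
  refine ⟨e', t', ht', ?_⟩
  rw [← basis_toMatrix_mul_linearMap_toMatrix_mul_basis_toMatrix e' e e' e, he', hA, mul_assoc, hAG,
    ← mul_assoc, ← he', e'.toMatrix_mul_toMatrix_flip, one_mul]

theorem exists_twist_eq (h : IsModel π n q M) (h' : IsModel π n q' M) :
    ∃ G : GL (Fin 2) R, q' = q.twist G := by
  obtain ⟨e, t, ht, hA⟩ := h
  obtain ⟨e', t', ht', hA'⟩ := h'
  let G : GL (Fin 2) R := ⟨e.toMatrix e', e'.toMatrix e, e.toMatrix_mul_toMatrix_flip e',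
    e'.toMatrix_mul_toMatrix_flip e⟩
  obtain ⟨t'', ht'', hAG⟩ := BinForm.exists_omegaMatrix_mul ht G
  refine ⟨G, BinForm.eq_of_omegaMatrix_eq ht' ht'' ?_⟩
  rw [← hA', ← basis_toMatrix_mul_linearMap_toMatrix_mul_basis_toMatrix e' e e' e, hA, mul_assoc]
  change _ * (_ * G.val) = _
  rw [hAG, ← mul_assoc]
  change G.inv * G.val * _ = _
  rw [G.inv_val, one_mul]

theorem nonempty_linearEquiv [IsDomain R] (h2 : (2 : R) ≠ 0) (h : IsModel π n q M)
    (h' : IsModel π n q M') : Nonempty (M ≃ₗ[QuadAlg π n] M') := by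
  obtain ⟨e, t, ht, hA⟩ := h
  obtain ⟨e', t', ht', hA'⟩ := h'
  obtain rfl : t = t' := mul_left_cancel₀ h2 (ht.trans ht'.symm)
  exact QuadAlg.nonempty_linearEquiv_of_toMatrix_eq e e' (hA.trans hA'.symm)

end IsModel

end Models

section IdealProducts

open Ideal

variable {S : Type*} [CommRing S] {a b c w w' : S}

theorem span_pair_mul_span_pair_of_isCoprime (h : IsCoprime a b) :
    span {w, a} * span {w, b} = span {w, a * b} := by
  obtain ⟨u, v, huv⟩ := h
  have hw_eq : w = u * (a * w) + v * (w * b) := by linear_combination -w * huv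
  refine le_antisymm ?_ (span_le.mpr ?_)
  · rw [span_pair_mul_span_pair, span_le]
    rintro _ (rfl | rfl | rfl | rfl) <;> rw [SetLike.mem_coe, mem_span_pair]
    exacts [⟨w, 0, by ring⟩, ⟨b, 0, by ring⟩, ⟨a, 0, by ring⟩, ⟨0, 1, by ring⟩]
  · have hw : ∀ x : S, w ∈ span {w, x} := fun x => subset_span (by simp)
    have hx : ∀ x : S, x ∈ span {w, x} := fun x => subset_span (by simp)
    have hw_mem : u * (a * w) + v * (w * b) ∈ span {w, a} * span {w, b} :=
      add_mem (mul_mem_left _ u (mul_mem_mul (hx a) (hw b)))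
        (mul_mem_left _ v (mul_mem_mul (hw a) (hx b)))
    rw [← hw_eq] at hw_mem
    exact Set.pair_subset hw_mem (mul_mem_mul (hx a) (hx b))

theorem span_pair_mul_span_pair_of_mul_eq (hmul : w * w' = -(a * c))
    (h : span {a, w' - w, c} = ⊤) : span {w, a} * span {w', a} = span {a} := by
  have hle : span {w, a} * span {w', a} ≤ span {a} := by
    rw [span_pair_mul_span_pair, span_le]
    rintro _ (rfl | rfl | rfl | rfl) <;> rw [SetLike.mem_coe, mem_span_singleton']
    exacts [⟨-c, by rw [hmul]; ring⟩, ⟨w, rfl⟩, ⟨w', mul_comm _ _⟩, ⟨a, rfl⟩]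
  refine hle.antisymm ?_
  calc span {a} = span {a} * span {a, w' - w, c} := by rw [h, mul_top]
    _ = span {a * a, a * (w' - w), a * c} := by
      simp only [span_mul_span', Set.singleton_mul, Set.image_insert_eq, Set.image_singleton]
    _ ≤ span {w, a} * span {w', a} := by
      have hw : w ∈ span {w, a} := subset_span (by simp)
      have ha : a ∈ span {w, a} := subset_span (by simp)
      have hw' : w' ∈ span {w', a} := subset_span (by simp)
      have ha' : a ∈ span {w', a} := subset_span (by simp)
      rw [span_le]
      rintro _ (rfl | rfl | rfl)
      · exact mul_mem_mul ha ha'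
      · rw [mul_sub, mul_comm a w]
        exact sub_mem (mul_mem_mul ha hw') (mul_mem_mul hw ha')
      · rw [← neg_neg (a * c), ← hmul]
        exact neg_mem (mul_mem_mul hw hw')

end IdealProducts

namespace QuadAlg

variable {R : Type*} [CommRing R] {π n t : R}

/-- The ideal `⟨ω + t, a⟩`, which is attached to the forms `[a, b, c]` with `t = (π - b)/2`. -/
def pairIdeal (π n a t : R) : Ideal (QuadAlg π n) :=
  Ideal.span {omega + algebraMap R (QuadAlg π n) t, algebraMap R (QuadAlg π n) a}

theorem pairIdeal_one : pairIdeal π n 1 t = ⊤ :=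
  (Ideal.eq_top_iff_one _).mpr (Ideal.subset_span (by simp))

theorem pairIdeal_mul_pairIdeal {a₁ a₂ : R} (h : IsCoprime a₁ a₂) :
    pairIdeal π n a₁ t * pairIdeal π n a₂ t = pairIdeal π n (a₁ * a₂) t := by
  rw [pairIdeal, pairIdeal, span_pair_mul_span_pair_of_isCoprime (h.map (algebraMap R _)),
    pairIdeal, map_mul]

theorem omega_add_mul_omega_add {q : BinForm R} (ht : q.HasShift π n t) :
    (omega + algebraMap R (QuadAlg π n) t) * (omega + algebraMap R _ (π - t)) =
      -(algebraMap R _ q.a * algebraMap R _ q.c) := by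
  have homega : (omega : QuadAlg π n) * omega = algebraMap R _ n - algebraMap R _ π * omega := by
    rw [omega_mul_omega_eq_add, Algebra.smul_def, Algebra.smul_def, map_neg]
    ring
  have hac := congrArg (algebraMap R (QuadAlg π n)) ht.a_mul_c
  simp only [map_sub, map_mul, map_pow] at hac ⊢
  linear_combination homega + hac

theorem pairIdeal_mul_pairIdeal_conj {q : BinForm R} (hq : q.IsPrimitive)
    (ht : q.HasShift π n t) :
    pairIdeal π n q.a t * pairIdeal π n q.a (π - t) = Ideal.span {algebraMap R _ q.a} := by
  refine span_pair_mul_span_pair_of_mul_eq (omega_add_mul_omega_add ht) ?_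
  have hsub : (omega + algebraMap R (QuadAlg π n) (π - t)) - (omega + algebraMap R _ t) =
      algebraMap R _ q.b := by
    rw [add_sub_add_left_eq_sub, ← map_sub]
    congr 1
    linear_combination -ht.two_mul_eq
  have hmap := congrArg (Ideal.map (algebraMap R (QuadAlg π n))) hq
  simpa only [hsub, Ideal.map_span, Set.image_insert_eq, Set.image_singleton, Ideal.map_top]
    using hmap

theorem isModel_pairIdeal [IsDomain R] {q : BinForm R} (ht : q.HasShift π n t) (ha : q.a ≠ 0) :
    IsModel π n q (pairIdeal π n q.a t) := by
  let x₀ : pairIdeal π n q.a t := ⟨algebraMap R _ q.a, Ideal.subset_span (by simp)⟩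
  let x₁ : pairIdeal π n q.a t :=
    ⟨-(omega + algebraMap R _ t), neg_mem (Ideal.subset_span (by simp))⟩
  have hω₀ : (omega : QuadAlg π n) • x₀ = -t • x₀ + -q.a • x₁ := by
    refine Subtype.ext ?_
    change omega * algebraMap R (QuadAlg π n) q.a =
      -t • algebraMap R _ q.a + -q.a • -(omega + algebraMap R _ t)
    simp only [Algebra.smul_def, map_neg]
    ring
  have hω₁ : (omega : QuadAlg π n) • x₁ = q.c • x₀ + (t - π) • x₁ := by
    refine Subtype.ext ?_
    change omega * -(omega + algebraMap R (QuadAlg π n) t) =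
      q.c • algebraMap R _ q.a + (t - π) • -(omega + algebraMap R _ t)
    have hnorm := omega_add_mul_omega_add ht
    simp only [Algebra.smul_def, map_sub] at hnorm ⊢
    linear_combination -hnorm
  have hindep : LinearIndependent R ![x₀, x₁] := by
    refine LinearIndependent.pair_iff.mpr fun r s h => ?_
    replace h := congrArg Subtype.val h
    have hs : s = 0 := by simpa [x₀, x₁] using congrArg QuadraticAlgebra.im h
    have hr : r = 0 := by simpa [x₀, x₁, hs, ha] using congrArg QuadraticAlgebra.re h
    exact ⟨hr, hs⟩
  have hspan : ⊤ ≤ Submodule.span R (Set.range ![x₀, x₁]) := by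
    rintro ⟨x, hx⟩ -
    obtain ⟨r, s, rfl⟩ := Ideal.mem_span_pair.mp hx
    have hrs : (⟨_, hx⟩ : pairIdeal π n q.a t) = s • x₀ - r • x₁ := Subtype.ext (by
      change _ = s * algebraMap R _ q.a - r * -(omega + algebraMap R _ t)
      ring)
    rw [Matrix.range_cons_cons_empty, Submodule.mem_span_pair, hrs, smul_eq s x₀, smul_eq r x₁,
      hω₀, hω₁]
    exact ⟨s.re - s.im * t - r.im * q.c, -s.im * q.a - r.re - r.im * (t - π), by module⟩
  refine ⟨Basis.mk hindep hspan, t, ht.two_mul_eq, (toMatrix_omegaEnd_eq_iff _).mpr ?_⟩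
  rw [Basis.mk_apply, Basis.mk_apply]
  exact ⟨hω₀, hω₁⟩

end QuadAlg

theorem aeval_charpoly_lsmul (R : Type*) {S : Type*} (M : Type*) [CommRing R] [CommRing S]
    [Algebra R S] [AddCommGroup M] [Module R M] [Module S M] [IsScalarTower R S M]
    [FaithfulSMul S M] [Module.Finite R M] [Free R M] (s : S) :
    Polynomial.aeval s (Algebra.lsmul R R M s).charpoly = 0 := by
  refine FaithfulSMul.eq_of_smul_eq_smul (α := M) fun m => ?_
  have h := (Algebra.lsmul R R M s).aeval_self_charpoly
  rw [Polynomial.aeval_algHom_apply] at h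
  rw [zero_smul]
  exact LinearMap.congr_fun h m

section InvertibleModules

variable {S M : Type*} [CommRing S] [AddCommGroup M] [Module S M] [Module.Invertible S M]

theorem mem_of_forall_smul_mem_smul_top {J : Ideal S} {x : S}
    (h : ∀ m : M, x • m ∈ J • (⊤ : Submodule S M)) : x ∈ J := by
  have hdual (f : Dual S M) (m : M) : x * f m ∈ J := by
    have hf : (J • (⊤ : Submodule S M)).map f ≤ J := by
      rw [Submodule.map_smul'']
      exact Ideal.mul_le_left
    rw [← smul_eq_mul, ← map_smul f]
    exact hf (Submodule.mem_map_of_mem (h m))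
  have hcontract (τ : Dual S M ⊗[S] M) : x * contractLeft S M τ ∈ J := by
    induction τ using TensorProduct.induction_on with
    | zero => simp only [map_zero, mul_zero, zero_mem]
    | tmul f m => exact hdual f m
    | add τ₁ τ₂ h₁ h₂ => simpa only [map_add, mul_add] using add_mem h₁ h₂
  obtain ⟨τ, hτ⟩ := (Module.Invertible.linearEquiv S M).surjective 1
  have hτ' : contractLeft S M τ = 1 := hτ
  simpa only [hτ', mul_one] using hcontract τ

end InvertibleModules

namespace QuadAlg

variable {R : Type*} [CommRing R] {π n : R}

theorem re_mem_and_im_mem_of_mem_map {I : Ideal R} {s : QuadAlg π n}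
    (hs : s ∈ I.map (algebraMap R (QuadAlg π n))) : s.re ∈ I ∧ s.im ∈ I := by
  induction hs using Submodule.span_induction with
  | mem _ hx =>
    obtain ⟨r, hr, rfl⟩ := hx
    exact ⟨hr, zero_mem I⟩
  | zero => exact ⟨zero_mem I, zero_mem I⟩
  | add x y _ _ hx hy => exact ⟨add_mem hx.1 hy.1, add_mem hx.2 hy.2⟩
  | smul r x _ hx =>
    rw [smul_eq_mul, re_mul, im_mul]
    exact ⟨add_mem (I.mul_mem_left _ hx.1) (I.mul_mem_left _ hx.2),
      add_mem (add_mem (I.mul_mem_left _ hx.2) (I.mul_mem_left _ hx.1)) (I.mul_mem_left _ hx.2)⟩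

variable {M : Type*} [AddCommGroup M] [Module R M] [Module (QuadAlg π n) M]
  [IsScalarTower R (QuadAlg π n) M]

theorem trace_eq_and_det_eq_of_basis [FaithfulSMul (QuadAlg π n) M] (e : Basis (Fin 2) R M) :
    (LinearMap.toMatrix e e (omegaEnd π n M)).trace = -π ∧
      (LinearMap.toMatrix e e (omegaEnd π n M)).det = -n := by
  nontriviality R
  have : Module.Finite R M := .of_basis e
  have : Free R M := .of_basis e
  have h := aeval_charpoly_lsmul R M (omega : QuadAlg π n)
  rw [← LinearMap.charpoly_toMatrix _ e, Matrix.charpoly_fin_two] at h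
  generalize LinearMap.toMatrix e e (omegaEnd π n M) = A at *
  simp only [map_add, map_sub, map_mul, map_pow, Polynomial.aeval_X, Polynomial.aeval_C] at h
  have hre := congrArg QuadraticAlgebra.re h
  have him := congrArg QuadraticAlgebra.im h
  simp only [pow_two, re_add, re_sub, re_mul, omega_re, mul_zero, omega_im, mul_one, zero_add,
    algebraMap_re, algebraMap_im, add_zero, sub_zero, re_zero, im_add, im_sub, im_mul,
    im_zero] at hre him
  exact ⟨by linear_combination -him, by linear_combination hre⟩

theorem exists_hasShift_of_basis [FaithfulSMul (QuadAlg π n) M] (e : Basis (Fin 2) R M) :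
    ∃ (q : BinForm R) (t : R), q.HasShift π n t ∧
      LinearMap.toMatrix e e (omegaEnd π n M) = q.omegaMatrix π t := by
  obtain ⟨htrace, hdet⟩ := trace_eq_and_det_eq_of_basis (π := π) (n := n) e
  generalize LinearMap.toMatrix e e (omegaEnd π n M) = A at *
  rw [Matrix.trace_fin_two] at htrace
  rw [Matrix.det_fin_two] at hdet
  obtain rfl : π = -(A 0 0 + A 1 1) := by linear_combination htrace
  refine ⟨⟨-A 1 0, -(A 0 0 + A 1 1) - 2 * -A 0 0, A 0 1⟩, -A 0 0, ⟨by ring, ?_⟩, ?_⟩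
  · linear_combination hdet
  · ext i j
    fin_cases i <;> fin_cases j <;> simp [BinForm.omegaMatrix]

theorem isPrimitive_of_toMatrix_eq [Module.Invertible (QuadAlg π n) M] {q : BinForm R} {t : R}
    (e : Basis (Fin 2) R M) (ht : 2 * t = π - q.b)
    (hA : LinearMap.toMatrix e e (omegaEnd π n M) = q.omegaMatrix π t) : q.IsPrimitive := by
  let I : Ideal R := Ideal.span {q.a, q.b, q.c}
  let J : Ideal (QuadAlg π n) := I.map (algebraMap R (QuadAlg π n))
  have hsmul {r : R} (hr : r ∈ I) (m : M) : r • m ∈ J • (⊤ : Submodule (QuadAlg π n) M) := by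
    rw [← algebraMap_smul (QuadAlg π n) r m]
    exact Submodule.smul_mem_smul (Ideal.mem_map_of_mem _ hr) Submodule.mem_top
  have ha : q.a ∈ I := Ideal.subset_span (by simp)
  have hb : q.b ∈ I := Ideal.subset_span (by simp)
  have hc : q.c ∈ I := Ideal.subset_span (by simp)
  obtain ⟨hω₀, hω₁⟩ := (toMatrix_omegaEnd_eq_iff e).mp hA
  have hb_eq : q.b = π - 2 * t := by linear_combination ht
  have h₀ : (omega + algebraMap R (QuadAlg π n) t) • e 0 = -(q.a • e 1) := by
    rw [add_smul, algebraMap_smul, hω₀]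
    module
  have h₁ : (omega + algebraMap R (QuadAlg π n) t) • e 1 = q.c • e 0 - q.b • e 1 := by
    rw [add_smul, algebraMap_smul, hω₁, hb_eq]
    module
  have hmem : omega + algebraMap R (QuadAlg π n) t ∈ J := by
    refine mem_of_forall_smul_mem_smul_top (M := M) fun m => ?_
    rw [← e.sum_repr m, Fin.sum_univ_two, smul_add, smul_comm _ (e.repr m 0),
      smul_comm _ (e.repr m 1), h₀, h₁]
    refine add_mem (Submodule.smul_of_tower_mem _ _ (neg_mem (hsmul ha _)))
      (Submodule.smul_of_tower_mem _ _ (sub_mem (hsmul hc _) (hsmul hb _)))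
  rw [BinForm.IsPrimitive, Ideal.eq_top_iff_one]
  simpa using (re_mem_and_im_mem_of_mem_map hmem).2

variable (π n M) in
theorem nonempty_basis [IsDomain R] [IsPrincipalIdealRing R] [Module.Invertible (QuadAlg π n) M] :
    Nonempty (Basis (Fin 2) R M) := by
  have : IsNoetherianRing (QuadAlg π n) := .of_finite R _
  obtain ⟨I, ⟨f⟩⟩ := Module.Invertible.exists_linearEquiv_ideal (QuadAlg π n) M
  let f' : M ≃ₗ[R] I.restrictScalars R := f.restrictScalars R
  have : Module.Finite R M := .equiv f'.symm
  have : Free R M := .of_equiv f'.symm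
  have hle : finrank R M ≤ 2 := by
    rw [f'.finrank_eq, ← finrank_eq_two (R := R) n (-π)]
    exact Submodule.finrank_le _
  refine ⟨finBasisOfFinrankEq R M (hle.antisymm ?_)⟩
  by_contra! hlt
  obtain ⟨v, hv⟩ := finrank_le_one_iff.mp (Nat.le_of_lt_succ hlt)
  obtain ⟨r, hr⟩ := hv ((omega : QuadAlg π n) • v)
  have homega : (omega : QuadAlg π n) = algebraMap R _ r := by
    refine FaithfulSMul.eq_of_smul_eq_smul (α := M) fun m => ?_
    obtain ⟨s, rfl⟩ := hv m
    rw [algebraMap_smul, smul_comm, ← hr, smul_comm]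
  simpa using congrArg QuadraticAlgebra.im homega

variable (π n M) in
theorem exists_isModel [IsDomain R] [IsPrincipalIdealRing R] [Module.Invertible (QuadAlg π n) M] :
    ∃ q : BinForm R, q.IsPrimitive ∧ q.disc = π ^ 2 + 4 * n ∧ IsModel π n q M := by
  obtain ⟨e⟩ := nonempty_basis π n M
  obtain ⟨q, t, ht, hA⟩ := exists_hasShift_of_basis (π := π) (n := n) e
  exact ⟨q, isPrimitive_of_toMatrix_eq e ht.two_mul_eq hA, ht.disc_eq, e, t, ht.two_mul_eq, hA⟩

end QuadAlg

section InvertibleIdeals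

open IsLocalization CommRing

variable {S A : Type*} [CommRing S] [CommRing A] [Algebra S A] {I J : Ideal S}

theorem isUnit_coeSubmodule_of_mul_eq_span_singleton {x : S} (hx : IsUnit (algebraMap S A x))
    (h : I * J = Ideal.span {x}) : IsUnit (coeSubmodule A I) := by
  refine isUnit_of_mul_isUnit_left (y := coeSubmodule A J) ?_
  rw [← coeSubmodule_mul, h, coeSubmodule_span_singleton]
  exact hx.map (Submodule.spanSingleton S)

variable [FaithfulSMul S A]

theorem eq_unitsToPic_iff {u : (Submodule S A)ˣ} (hu : u = coeSubmodule A I) {P : Pic S} :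
    P = Submodule.unitsToPic S A u ↔ Nonempty (P.AsModule ≃ₗ[S] I) := by
  have e : Submodule.unitsToPic S A u ≃ₗ[S] I :=
    Submodule.unitsToPicEquiv u ≪≫ₗ LinearEquiv.ofEq _ _ hu ≪≫ₗ
      (Submodule.equivMapOfInjective (Algebra.linearMap S A)
        (FaithfulSMul.algebraMap_injective S A) I).symm
  rw [Pic.ext_iff]
  exact ⟨fun ⟨f⟩ => ⟨f ≪≫ₗ e⟩, fun ⟨f⟩ => ⟨f ≪≫ₗ e.symm⟩⟩

theorem exists_pic_linearEquiv (hI : IsUnit (coeSubmodule A I)) :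
    ∃ P : Pic S, Nonempty (P.AsModule ≃ₗ[S] I) := by
  obtain ⟨u, hu⟩ := hI
  exact ⟨_, (eq_unitsToPic_iff hu).mp rfl⟩

theorem pic_mul_linearEquiv (hI : IsUnit (coeSubmodule A I)) (hJ : IsUnit (coeSubmodule A J))
    {P Q : Pic S} (hP : Nonempty (P.AsModule ≃ₗ[S] I)) (hQ : Nonempty (Q.AsModule ≃ₗ[S] J)) :
    Nonempty ((P * Q).AsModule ≃ₗ[S] (I * J : Ideal S)) := by
  obtain ⟨u, hu⟩ := hI
  obtain ⟨v, hv⟩ := hJ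
  have huv : (u * v : (Submodule S A)ˣ) = coeSubmodule A (I * J) := by
    rw [Units.val_mul, hu, hv, coeSubmodule_mul]
  rw [← eq_unitsToPic_iff huv, map_mul, (eq_unitsToPic_iff hu).mpr hP,
    (eq_unitsToPic_iff hv).mpr hQ]

end InvertibleIdeals

namespace QuadAlg

variable {R : Type*} [CommRing R] {π n t : R}

theorem isUnit_coeSubmodule_pairIdeal [IsDomain R] {q : BinForm R} (hq : q.IsPrimitive)
    (ht : q.HasShift π n t) (ha : q.a ≠ 0) :
    IsUnit (IsLocalization.coeSubmodule (FractionRing (QuadAlg π n)) (pairIdeal π n q.a t)) :=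
  isUnit_coeSubmodule_of_mul_eq_span_singleton
    (IsLocalization.map_units _ ⟨_, algebraMap_mem_nonZeroDivisors_iff.mpr
      (mem_nonZeroDivisors_of_ne_zero ha)⟩) (pairIdeal_mul_pairIdeal_conj hq ht)

noncomputable instance (P : CommRing.Pic (QuadAlg π n)) : Module R P.AsModule :=
  Module.compHom _ (algebraMap R (QuadAlg π n))

instance (P : CommRing.Pic (QuadAlg π n)) : IsScalarTower R (QuadAlg π n) P.AsModule :=
  .of_algebraMap_smul fun _ _ => rfl

end QuadAlg

section Correspondence

open CommRing

variable {R : Type*} [CommRing R] {Δ π n t : R}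

/-- The correspondence between form classes and module classes: `P` is the class of the models of
the forms in `X`. -/
def TwistedClass.Corresponds (X : TwistedClass R Δ) (P : Pic (QuadAlg π n)) : Prop :=
  ∃ q : PrimForm R Δ, q.toClass = X ∧ IsModel π n q.1 P.AsModule

theorem PrimForm.corresponds_toClass_iff {q : PrimForm R Δ} {P : Pic (QuadAlg π n)} :
    q.toClass.Corresponds P ↔ IsModel π n q.1 P.AsModule := by
  refine ⟨?_, fun h => ⟨q, rfl, h⟩⟩
  rintro ⟨q', hq', h⟩
  obtain ⟨G, hG⟩ := PrimForm.toClass_eq_toClass.mp hq'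
  exact hG ▸ h.twist G

theorem TwistedClass.Corresponds.class_eq {X Y : TwistedClass R Δ} {P : Pic (QuadAlg π n)}
    (hX : X.Corresponds P) (hY : Y.Corresponds P) : X = Y := by
  obtain ⟨q, rfl, hq⟩ := hX
  obtain ⟨q', rfl, hq'⟩ := hY
  exact PrimForm.toClass_eq_toClass.mpr (hq.exists_twist_eq hq')

section IsDomain

variable [IsDomain R]

theorem TwistedClass.Corresponds.pic_eq (h2 : (2 : R) ≠ 0) {X : TwistedClass R Δ}
    {P Q : Pic (QuadAlg π n)} (hP : X.Corresponds P) (hQ : X.Corresponds Q) : P = Q := by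
  obtain ⟨q, rfl, hq⟩ := hP
  exact Pic.ext_iff.mpr (hq.nonempty_linearEquiv h2 (PrimForm.corresponds_toClass_iff.mp hQ))

theorem PrimForm.corresponds_toClass_iff_nonempty_linearEquiv (h2 : (2 : R) ≠ 0)
    {q : PrimForm R Δ} (ht : q.1.HasShift π n t) (ha : q.1.a ≠ 0) {P : Pic (QuadAlg π n)} :
    q.toClass.Corresponds P ↔
      Nonempty (P.AsModule ≃ₗ[QuadAlg π n] QuadAlg.pairIdeal π n q.1.a t) := by
  have h := QuadAlg.isModel_pairIdeal ht ha
  rw [corresponds_toClass_iff]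
  exact ⟨fun h' => h'.nonempty_linearEquiv h2 h, fun ⟨f⟩ => h.congr f.symm⟩

theorem PrimForm.IsConcordant.exists_corresponds_mul (h2 : (2 : R) ≠ 0) {q₁ q₂ : PrimForm R Δ}
    (h : IsConcordant π n t q₁ q₂) {P₁ P₂ : Pic (QuadAlg π n)} (hP₁ : q₁.toClass.Corresponds P₁)
    (hP₂ : q₂.toClass.Corresponds P₂) :
    ∃ q : PrimForm R Δ, q.1.a = q₁.1.a * q₂.1.a ∧ q.1.HasShift π n t ∧
      q.toClass.Corresponds (P₁ * P₂) := by
  obtain ⟨q, hqa, hqt⟩ := exists_a_eq_mul_hasShift h.hasShift_left h.hasShift_right h.isCoprime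
  refine ⟨q, hqa, hqt, (corresponds_toClass_iff_nonempty_linearEquiv h2 hqt
    (hqa ▸ mul_ne_zero h.a_left_ne_zero h.a_right_ne_zero)).mpr ?_⟩
  rw [hqa, ← QuadAlg.pairIdeal_mul_pairIdeal h.isCoprime]
  exact pic_mul_linearEquiv
    (QuadAlg.isUnit_coeSubmodule_pairIdeal q₁.2.1 h.hasShift_left h.a_left_ne_zero)
    (QuadAlg.isUnit_coeSubmodule_pairIdeal q₂.2.1 h.hasShift_right h.a_right_ne_zero)
    ((corresponds_toClass_iff_nonempty_linearEquiv h2 h.hasShift_left h.a_left_ne_zero).mp hP₁)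
    ((corresponds_toClass_iff_nonempty_linearEquiv h2 h.hasShift_right h.a_right_ne_zero).mp hP₂)

section IsPrincipalIdealRing

variable [IsPrincipalIdealRing R]

theorem TwistedClass.exists_corresponds (h2 : (2 : R) ≠ 0) (hπ : Δ = π ^ 2 + 4 * n)
    (X : TwistedClass R Δ) : ∃ P : Pic (QuadAlg π n), X.Corresponds P := by
  obtain ⟨q, rfl, ha, -⟩ := X.exists_isCoprime_a one_ne_zero
  obtain ⟨t, ht⟩ := BinForm.exists_hasShift h2 (q.2.2.trans hπ)
  obtain ⟨P, hP⟩ := exists_pic_linearEquiv (QuadAlg.isUnit_coeSubmodule_pairIdeal q.2.1 ht ha)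
  exact ⟨P, (PrimForm.corresponds_toClass_iff_nonempty_linearEquiv h2 ht ha).mpr hP⟩

theorem exists_class_corresponds (hπ : Δ = π ^ 2 + 4 * n) (P : Pic (QuadAlg π n)) :
    ∃ X : TwistedClass R Δ, X.Corresponds P := by
  obtain ⟨q, hq, hdisc, h⟩ := QuadAlg.exists_isModel π n P.AsModule
  exact ⟨PrimForm.toClass ⟨q, hq, hdisc.trans hπ.symm⟩, _, rfl, h⟩

/-- The bijection between form classes and module classes given by
`TwistedClass.Corresponds`, along which the composition law is transported. -/
noncomputable def TwistedClass.equivPic (h2 : (2 : R) ≠ 0) (hπ : Δ = π ^ 2 + 4 * n) :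
    TwistedClass R Δ ≃ Pic (QuadAlg π n) :=
  .ofBijective (fun X => (X.exists_corresponds h2 hπ).choose) <| by
    have hspec (X : TwistedClass R Δ) := (X.exists_corresponds h2 hπ).choose_spec
    refine ⟨fun X Y (h : Exists.choose _ = _) => (h ▸ hspec X).class_eq (hspec Y), fun P => ?_⟩
    obtain ⟨X, hX⟩ := exists_class_corresponds hπ P
    exact ⟨X, (hspec X).pic_eq h2 hX⟩

theorem TwistedClass.corresponds_iff_equivPic_eq (h2 : (2 : R) ≠ 0) (hπ : Δ = π ^ 2 + 4 * n)
    {X : TwistedClass R Δ} {P : Pic (QuadAlg π n)} : X.Corresponds P ↔ equivPic h2 hπ X = P := by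
  have hX : X.Corresponds (equivPic h2 hπ X) := (X.exists_corresponds h2 hπ).choose_spec
  exact ⟨hX.pic_eq h2, fun h => h ▸ hX⟩

theorem isCompositionLaw_iff (h2 : (2 : R) ≠ 0) (hπ : Δ = π ^ 2 + 4 * n)
    (G : CommGroup (TwistedClass R Δ)) :
    IsCompositionLaw π n G ↔ ∀ X Y : TwistedClass R Δ, TwistedClass.equivPic h2 hπ (X * Y) =
      TwistedClass.equivPic h2 hπ X * TwistedClass.equivPic h2 hπ Y := by
  constructor
  · rintro ⟨Φ, hΦ⟩
    have hΦ_eq (X : TwistedClass R Δ) : TwistedClass.equivPic h2 hπ X = Φ X := by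
      obtain ⟨q, rfl, ha, -⟩ := X.exists_isCoprime_a one_ne_zero
      obtain ⟨t, ht, hI⟩ := hΦ q ha
      have hshift := BinForm.hasShift_of_two_mul_eq h2 (q.2.2.trans hπ) ht
      exact (TwistedClass.corresponds_iff_equivPic_eq h2 hπ).mp
        ((PrimForm.corresponds_toClass_iff_nonempty_linearEquiv h2 hshift ha).mpr hI)
    intro X Y
    simp only [hΦ_eq, map_mul]
  · refine fun h => ⟨{ TwistedClass.equivPic h2 hπ with map_mul' := h }, fun q ha => ?_⟩
    obtain ⟨t, ht⟩ := BinForm.exists_hasShift h2 (q.2.2.trans hπ)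
    exact ⟨t, ht.two_mul_eq, (PrimForm.corresponds_toClass_iff_nonempty_linearEquiv h2 ht ha).mp
      ((TwistedClass.corresponds_iff_equivPic_eq h2 hπ).mpr rfl)⟩

theorem existsUnique_isCompositionLaw (h2 : (2 : R) ≠ 0) (hπ : Δ = π ^ 2 + 4 * n) :
    ∃! G : CommGroup (TwistedClass R Δ), IsCompositionLaw π n G := by
  let Φ : TwistedClass R Δ ≃ Pic (QuadAlg π n) := TwistedClass.equivPic h2 hπ
  refine ⟨Φ.commGroup, (isCompositionLaw_iff h2 hπ _).mpr fun X Y => Φ.apply_symm_apply _,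
    fun G hG => CommGroup.ext (funext₂ fun X Y => ?_)⟩
  exact Φ.eq_symm_apply.mpr ((isCompositionLaw_iff h2 hπ G).mp hG X Y)

namespace IsCompositionLaw

variable [G : CommGroup (TwistedClass R Δ)]

theorem exists_toClass_eq_mul (hG : IsCompositionLaw π n G) (h2 : (2 : R) ≠ 0)
    (hπ : Δ = π ^ 2 + 4 * n) {q₁ q₂ : PrimForm R Δ} (h : PrimForm.IsConcordant π n t q₁ q₂) :
    ∃ q : PrimForm R Δ, q.1.a = q₁.1.a * q₂.1.a ∧ q.1.HasShift π n t ∧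
      q.toClass = q₁.toClass * q₂.toClass := by
  obtain ⟨q, ha, ht, hq⟩ := h.exists_corresponds_mul h2
    ((TwistedClass.corresponds_iff_equivPic_eq h2 hπ).mpr rfl)
    ((TwistedClass.corresponds_iff_equivPic_eq h2 hπ).mpr rfl)
  refine ⟨q, ha, ht, hq.class_eq ?_⟩
  rw [TwistedClass.corresponds_iff_equivPic_eq h2 hπ, (isCompositionLaw_iff h2 hπ G).mp hG]

theorem toClass_principalForm (hG : IsCompositionLaw π n G) (h2 : (2 : R) ≠ 0)
    (hπ : Δ = π ^ 2 + 4 * n) : (principalForm π n hπ).toClass = 1 := by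
  have hshift : (principalForm π n hπ).1.HasShift π n 0 :=
    ⟨by simp [principalForm], by simp [principalForm]⟩
  have hone : TwistedClass.equivPic h2 hπ (1 : TwistedClass R Δ) = 1 :=
    (left_eq_mul (a := TwistedClass.equivPic h2 hπ 1)).mp
      (by rw [← (isCompositionLaw_iff h2 hπ G).mp hG, mul_one])
  refine (TwistedClass.equivPic h2 hπ).injective (Eq.trans ?_ hone.symm)
  rw [← TwistedClass.corresponds_iff_equivPic_eq,
    PrimForm.corresponds_toClass_iff_nonempty_linearEquiv h2 hshift one_ne_zero]
  obtain ⟨f⟩ := Pic.mk_eq_one_iff.mp (Pic.mk_eq_self (M := (1 : Pic (QuadAlg π n))))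
  exact ⟨f ≪≫ₗ (LinearEquiv.ofTop _ QuadAlg.pairIdeal_one).symm⟩

end IsCompositionLaw

end IsPrincipalIdealRing

end IsDomain

end Correspondence

section Genus

variable {R : Type*} [CommRing R] {Δ π n t : R}

/-- The group `(R/Δ)ˣ/H₀` in which the genus map takes its values. -/
abbrev GenusGroup (hπ : Δ = π ^ 2 + 4 * n) : Type _ :=
  (R ⧸ Ideal.span {Δ})ˣ ⧸ principalValues π n hπ

theorem sq_mem_principalValues (hπ : Δ = π ^ 2 + 4 * n) (u : (R ⧸ Ideal.span {Δ})ˣ) :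
    u ^ 2 ∈ principalValues π n hπ :=
  (PrimForm.mem_values_toClass _ _).mpr ⟨1, u, 0, by simp [BinForm.eval, principalForm]⟩

theorem GenusGroup.sq_eq_one {hπ : Δ = π ^ 2 + 4 * n} (g : GenusGroup hπ) : g ^ 2 = 1 := by
  obtain ⟨u, rfl⟩ := QuotientGroup.mk_surjective g
  exact (QuotientGroup.eq_one_iff _).mpr (sq_mem_principalValues hπ u)

theorem GenusGroup.mk_eq_mk_iff {hπ : Δ = π ^ 2 + 4 * n} {u v : (R ⧸ Ideal.span {Δ})ˣ} :
    (v : GenusGroup hπ) = u ↔ u * v ∈ principalValues π n hπ := by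
  have hinv : (u : GenusGroup hπ)⁻¹ = u :=
    inv_eq_of_mul_eq_one_left (by rw [← pow_two, sq_eq_one])
  rw [← QuotientGroup.eq_one_iff, QuotientGroup.mk_mul, mul_eq_one_iff_inv_eq, hinv, eq_comm]

theorem square_le_ker {G H : Type*} [CommGroup G] [Group H] (hH : ∀ h : H, h ^ 2 = 1)
    (f : G →* H) : Subgroup.square G ≤ f.ker := by
  intro g hg
  obtain ⟨x, rfl⟩ := Subgroup.mem_square.mp hg
  rw [MonoidHom.mem_ker, map_mul, ← pow_two, hH]

theorem BinForm.HasShift.a_mul_eval {q : BinForm R} (h : q.HasShift π n t) {A : Type*}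
    [CommRing A] [Algebra R A] (x y : A) : algebraMap R A q.a * q.eval x y =
      (⟨1, π, -n⟩ : BinForm R).eval (algebraMap R A q.a * x - algebraMap R A t * y) y := by
  have htwo := congrArg (algebraMap R A) h.two_mul_eq
  have hac := congrArg (algebraMap R A) h.a_mul_c
  simp only [map_mul, map_sub, map_pow, map_ofNat] at htwo hac
  simp only [BinForm.eval, map_one, map_neg]
  linear_combination y ^ 2 * hac + algebraMap R A q.a * x * y * htwo

theorem PrimForm.mem_values_toClass_iff_mul_mem (hπ : Δ = π ^ 2 + 4 * n) {q : PrimForm R Δ}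
    (ht : q.1.HasShift π n t) {u : (R ⧸ Ideal.span {Δ})ˣ}
    (hu : (u : R ⧸ Ideal.span {Δ}) = algebraMap R _ q.1.a) (v : (R ⧸ Ideal.span {Δ})ˣ) :
    v ∈ q.toClass.values ↔ u * v ∈ principalValues π n hπ := by
  have hmul (e x y : R ⧸ Ideal.span {Δ}) :
      (v : R ⧸ Ideal.span {Δ}) = e * q.1.eval x y ↔ ((u * v : _) : R ⧸ Ideal.span {Δ}) =
        e * (principalForm π n hπ).1.eval (algebraMap R _ q.1.a * x - algebraMap R _ t * y) y := by
    rw [principalForm, ← ht.a_mul_eval, ← hu, Units.val_mul, mul_left_comm, u.mul_right_inj]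
  rw [mem_values_toClass]
  refine Iff.trans (exists_congr fun e => ?_) (mem_values_toClass _ _).symm
  constructor
  · rintro ⟨x, y, h⟩
    exact ⟨_, y, (hmul _ x y).mp h⟩
  · rintro ⟨z, y, h⟩
    refine ⟨(u⁻¹ : (R ⧸ Ideal.span {Δ})ˣ) * (z + algebraMap R _ t * y), y, (hmul _ _ y).mpr ?_⟩
    rwa [← hu, u.mul_inv_cancel_left, add_sub_cancel_right]

theorem PrimForm.preimage_mk_eq_values (hπ : Δ = π ^ 2 + 4 * n) {q : PrimForm R Δ}
    (ht : q.1.HasShift π n t) {u : (R ⧸ Ideal.span {Δ})ˣ}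
    (hu : (u : R ⧸ Ideal.span {Δ}) = algebraMap R _ q.1.a) :
    (QuotientGroup.mk : _ → GenusGroup hπ) ⁻¹' {(u : GenusGroup hπ)} = q.toClass.values :=
  Set.ext fun v => GenusGroup.mk_eq_mk_iff.trans (mem_values_toClass_iff_mul_mem hπ ht hu v).symm

theorem exists_unit_quotient_of_isCoprime {a : R} (h : IsCoprime a Δ) :
    ∃ u : (R ⧸ Ideal.span {Δ})ˣ, (u : R ⧸ Ideal.span {Δ}) = algebraMap R _ a := by
  have hΔ : algebraMap R (R ⧸ Ideal.span {Δ}) Δ = 0 := Ideal.Quotient.mk_singleton_self Δ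
  exact isCoprime_zero_right.mp (hΔ ▸ h.map (algebraMap R (R ⧸ Ideal.span {Δ})))

variable [IsDomain R] [IsPrincipalIdealRing R]

theorem TwistedClass.exists_preimage_mk_eq_values (h2 : (2 : R) ≠ 0) (hΔ : Δ ≠ 0)
    (hπ : Δ = π ^ 2 + 4 * n) (X : TwistedClass R Δ) :
    ∃ g : GenusGroup hπ, (QuotientGroup.mk : _ → GenusGroup hπ) ⁻¹' {g} = X.values := by
  obtain ⟨q, rfl, -, hco⟩ := X.exists_isCoprime_a hΔ
  obtain ⟨t, ht⟩ := BinForm.exists_hasShift h2 (q.2.2.trans hπ)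
  obtain ⟨u, hu⟩ := exists_unit_quotient_of_isCoprime hco
  exact ⟨u, PrimForm.preimage_mk_eq_values hπ ht hu⟩

/-- The set of values of a class of forms, as an element of `(R/Δ)ˣ/H₀`. -/
noncomputable def TwistedClass.genus (h2 : (2 : R) ≠ 0) (hΔ : Δ ≠ 0) (hπ : Δ = π ^ 2 + 4 * n)
    (X : TwistedClass R Δ) : GenusGroup hπ :=
  (X.exists_preimage_mk_eq_values h2 hΔ hπ).choose

theorem TwistedClass.preimage_genus (h2 : (2 : R) ≠ 0) (hΔ : Δ ≠ 0) (hπ : Δ = π ^ 2 + 4 * n)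
    (X : TwistedClass R Δ) :
    (QuotientGroup.mk : _ → GenusGroup hπ) ⁻¹' {X.genus h2 hΔ hπ} = X.values :=
  (X.exists_preimage_mk_eq_values h2 hΔ hπ).choose_spec

theorem PrimForm.genus_toClass (h2 : (2 : R) ≠ 0) (hΔ : Δ ≠ 0) (hπ : Δ = π ^ 2 + 4 * n)
    {q : PrimForm R Δ} (ht : q.1.HasShift π n t) {u : (R ⧸ Ideal.span {Δ})ˣ}
    (hu : (u : R ⧸ Ideal.span {Δ}) = algebraMap R _ q.1.a) : q.toClass.genus h2 hΔ hπ = u := by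
  have h := (q.toClass.preimage_genus h2 hΔ hπ).trans (preimage_mk_eq_values hπ ht hu).symm
  exact Set.singleton_injective (QuotientGroup.mk_surjective.preimage_injective h)

theorem IsCompositionLaw.genus_mul [G : CommGroup (TwistedClass R Δ)]
    (hG : IsCompositionLaw π n G) (h2 : (2 : R) ≠ 0) (hΔ : Δ ≠ 0) (hπ : Δ = π ^ 2 + 4 * n)
    (X Y : TwistedClass R Δ) :
    (X * Y).genus h2 hΔ hπ = X.genus h2 hΔ hπ * Y.genus h2 hΔ hπ := by
  obtain ⟨q₁, q₂, t, rfl, rfl, h⟩ := TwistedClass.exists_isConcordant h2 hΔ hπ X Y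
  obtain ⟨q, ha, ht, hq⟩ := hG.exists_toClass_eq_mul h2 hπ h
  obtain ⟨u₁, hu₁⟩ := exists_unit_quotient_of_isCoprime h.isCoprime_left_disc
  obtain ⟨u₂, hu₂⟩ := exists_unit_quotient_of_isCoprime h.isCoprime_right_disc
  have hu : ((u₁ * u₂ : _) : R ⧸ Ideal.span {Δ}) = algebraMap R _ q.1.a := by
    rw [Units.val_mul, hu₁, hu₂, ha, map_mul]
  rw [← hq, PrimForm.genus_toClass h2 hΔ hπ ht hu,
    PrimForm.genus_toClass h2 hΔ hπ h.hasShift_left hu₁,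
    PrimForm.genus_toClass h2 hΔ hπ h.hasShift_right hu₂, QuotientGroup.mk_mul]

end Genus

theorem mainTheorem3 {R : Type*} [CommRing R] [IsDomain R] [IsPrincipalIdealRing R]
    (h2 : (2 : R) ≠ 0) (Δ : R) (hΔ : Δ ≠ 0) (π n : R) (hπ : Δ = π ^ 2 + 4 * n) :
    (∃! G : CommGroup (TwistedClass R Δ), IsCompositionLaw π n G) ∧
    ∀ G : CommGroup (TwistedClass R Δ), IsCompositionLaw π n G →
      (principalForm π n hπ).toClass = (1 : TwistedClass R Δ) ∧
      ∃ ψ : TwistedClass R Δ →* (R ⧸ Ideal.span {Δ})ˣ ⧸ principalValues π n hπ,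
        (∀ X : TwistedClass R Δ,
          (QuotientGroup.mk : (R ⧸ Ideal.span {Δ})ˣ →
            (R ⧸ Ideal.span {Δ})ˣ ⧸ principalValues π n hπ) ⁻¹' {ψ X} = X.values) ∧
        Subgroup.square (TwistedClass R Δ) ≤ ψ.ker ∧
        ∃! Ψ : TwistedClass R Δ ⧸ Subgroup.square (TwistedClass R Δ) →*
            (R ⧸ Ideal.span {Δ})ˣ ⧸ principalValues π n hπ,
          Ψ.comp (QuotientGroup.mk' (Subgroup.square (TwistedClass R Δ))) = ψ := by
  refine ⟨existsUnique_isCompositionLaw h2 hπ,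
    fun G hG => ⟨hG.toClass_principalForm h2 hπ, ?_⟩⟩
  let ψ : TwistedClass R Δ →* GenusGroup hπ :=
    .mk' (TwistedClass.genus h2 hΔ hπ) (hG.genus_mul h2 hΔ hπ)
  have hker : Subgroup.square (TwistedClass R Δ) ≤ ψ.ker := square_le_ker GenusGroup.sq_eq_one ψ
  have hlift := QuotientGroup.lift_comp_mk' _ ψ hker
  exact ⟨ψ, TwistedClass.preimage_genus h2 hΔ hπ, hker, QuotientGroup.lift _ ψ hker, hlift,
    fun Ψ hΨ => QuotientGroup.monoidHom_ext _ (hΨ.trans hlift.symm)⟩
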